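/- All sets are finite and all Hilbert spaces are finite-dimensional and nonzero. $\mathsf{L}(\mathcal H)$ denotes the linear operators on $\mathcal H$ and $\mathsf{S}(\mathcal H)$ the density operators (positive semidefinite, trace one). For a cq-state $\rho_{UQ}=\sum_{u}p(u)|u\rangle\langle u|_U\otimes\rho^u_Q$ (with $p$ a probability distribution and $\rho^u_Q$ density operators) the guessing probability is \[P_{\mathrm{guess}}(U|Q)_\rho=\max_{P}\sum_{u}p(u)\operatorname{Tr}[\rho^u_Q P^u],\] the maximum being over all POVMs $\{P^u\}_{u\in\mathcal U}$ on $\mathcal H_Q$ (i.e. $P^u\ge 0$, $\sum_u P^u=\mathbb 1$). For a bipartite density operator $\rho_{AQ}$ the conditional min-entropy is \[H_{\min}(A|Q)_\rho=-\inf_{\sigma_Q\in\mathsf S(\mathcal H_Q)}\inf\{\lambda\in\mathbb R:\rho_{AQ}\le 2^\lambda\,\mathbb 1_A\otimes\sigma_Q\}.\] **Corollary.** Let $\{\sigma^x_R:x\in\mathcal X\}\subset\mathsf S(\mathcal H_R)$ and $\{\tau^x_S:x\in\mathcal X\}\subset\mathsf S(\mathcal H_S)$ be two families of density operators (cq-channels).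 Let $\mathcal H_{S'}\cong\mathcal H_S$ be an auxiliary Hilbert space and let $\{\omega^y_{S'}:y\in\mathcal Y\}\subset\mathsf S(\mathcal H_{S'})$ be a family of density operators with $\operatorname{span}_{\mathbb C}\{\omega^y_{S'}:y\in\mathcal Y\}=\mathsf L(\mathcal H_{S'})$. For a finite set $\mathcal U$, a probability distribution $q(u)$ on $\mathcal U$ and a classical channel (conditional probability distribution) $q(y,x|u)$, put \[\sigma_{US'R}=\sum_{y,x,u}q(u)\,q(y,x|u)\,|u\rangle\langle u|_U\otimes\omega^y_{S'}\otimes\sigma^x_R,\qquad \tau_{US'S}=\sum_{y,x,u}q(u)\,q(y,x|u)\,|u\rangle\langle u|_U\otimes\omega^y_{S'}\otimes\tau^x_S .\] Then the following are equivalent: 1. for every finite set $\mathcal U$, every $q(u)$ and every $q(y,x|u)$, $H_{\min}(U|S'R)_\sigma\le H_{\min}(U|S'S)_\tau$; 2. for every finite set $\mathcal U$, every $q(u)$ and every $q(y,x|u)$, $P_{\mathrm{guess}}(U|S'R)_\sigma\ge P_{\mathrm{guess}}(U|S'S)_\tau$; 3. there exists a completely positive trace-preserving linear map $\mathcal T:\mathsf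 L(\mathcal H_R)\to\mathsf L(\mathcal H_S)$ such that $\tau^x_S=\mathcal T(\sigma^x_R)$ for all $x\in\mathcal X$. -/

import Mathlib

open scoped Matrix.Norms.L2Operator MatrixOrder ComplexOrder CStarAlgebra Kronecker

noncomputable section

namespace CQ

/-- Density operators on the finite-dimensional Hilbert space `ℂ^n`; operators are written as
matrices in a fixed orthonormal basis. -/
def IsDensity {n : Type*} [Fintype n] (ρ : Matrix n n ℂ) : Prop :=
  ρ.PosSemidef ∧ ρ.trace = 1

/-- POVMs on `ℂ^n` with finite outcome set `U`. -/
def IsPOVM {U n : Type*} [Fintype U] [Fintype n] [DecidableEq n] (P : U → Matrix n n ℂ) : Prop :=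
  (∀ u, (P u).PosSemidef) ∧ ∑ u, P u = 1

/-- The cq-state `∑ u, p(u) |u⟩⟨u| ⊗ ρ^u`. -/
def cqState {U n : Type*} [Fintype U] [DecidableEq U] (p : U → ℝ) (ρ : U → Matrix n n ℂ) :
    Matrix (U × n) (U × n) ℂ :=
  ∑ u, p u • (Matrix.single u u (1 : ℂ) ⊗ₖ ρ u)

/-- The conditional min-entropy `H_min(A|B)_ρ` of a bipartite operator `ρ` on `ℂ^a ⊗ ℂ^b`,
`- inf_σ inf {l : ρ ≤ 2^l (1 ⊗ σ)}` over density operators `σ` on `ℂ^b`. The two infima are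
merged into one, so that a `σ` for which no `l` is feasible contributes nothing. -/
def Hmin {a b : Type*} [Fintype a] [Fintype b] [DecidableEq a] [DecidableEq b]
    (ρ : Matrix (a × b) (a × b) ℂ) : ℝ :=
  -sInf {l : ℝ | ∃ σ : Matrix b b ℂ, IsDensity σ ∧
    ρ ≤ (2 : ℝ) ^ l • ((1 : Matrix a a ℂ) ⊗ₖ σ)}

/-- The guessing probability `P_guess(U|Q)` of the cq-state `∑ u, p(u) |u⟩⟨u| ⊗ ρ^u`. -/
def guessProb {U n : Type*} [Fintype U] [Fintype n] [DecidableEq n]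
    (p : U → ℝ) (ρ : U → Matrix n n ℂ) : ℝ :=
  sSup {v : ℝ | ∃ P : U → Matrix n n ℂ, IsPOVM P ∧ v = ∑ u, p u * ((ρ u * P u).trace).re}

/-- The average state `∑ y, ∑ x, c(y,x) ω^y ⊗ σ^x` prepared when the pair `(y,x)` is drawn with
probability `c(y,x)`. -/
def mixture {X Y m n : Type*} [Fintype X] [Fintype Y] (c : Y × X → ℝ)
    (ω : Y → Matrix m m ℂ) (σ : X → Matrix n n ℂ) : Matrix (m × n) (m × n) ℂ :=
  ∑ y, ∑ x, c (y, x) • (ω y ⊗ₖ σ x)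

end CQ

end

/-!
The conditional min-entropy of a cq-state is minus the logarithm of its guessing probability. This
is minimax duality: by Sion's theorem the Lagrangian `Re Tr[(ρ - v (1 ⊗ σ)) B]` has a saddle point
`(σ, B)`, and the blocks of a dual feasible `B` on the diagonal are measurement operators. Guessing
probabilities decrease under channels, because a channel pulls POVMs back to POVMs.

Conversely, suppose that `σ` is at least as good as `τ` in every guessing game, and fix a POVM `P`
on `S'S`. By separation, a single POVM `Q` on `S'R` reproduces all the statistics
`Tr[(ω^y ⊗ τ^x) P^u]` on the states `ω^y ⊗ σ^x`. Since the `ω^y` span, `ω^y` may be replaced by any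
operator on `S'`, so that `Q` on `σ^x` is indistinguishable from `P` on `τ^x` even when `S'` is one
half of a maximally entangled pair. For the Bell measurement `P` this means that measuring `Q` and
applying the corrections of the teleportation protocol turns `σ^x` into `τ^x`.
-/

namespace CQ

open Matrix

section TracePairing

variable {n : Type*} [Fintype n]

/-- The real bilinear form `(A, B) ↦ Re Tr[A B]`; for a state `ρ` and an effect `P` it is the
probability of the effect, and on Hermitian matrices the real part loses nothing. -/
noncomputable def tracePairing : Matrix n n ℂ →ₗ[ℝ] Matrix n n ℂ →ₗ[ℝ] ℝ :=
  (LinearMap.mul ℝ (Matrix n n ℂ)).compr₂ (Complex.reLm ∘ₗ traceLinearMap n ℝ ℂ)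

theorem tracePairing_apply (A B : Matrix n n ℂ) : tracePairing A B = ((A * B).trace).re := rfl

theorem tracePairing_comm (A B : Matrix n n ℂ) : tracePairing A B = tracePairing B A := by
  rw [tracePairing_apply, trace_mul_comm, tracePairing_apply]

theorem tracePairing_one_right [DecidableEq n] (A : Matrix n n ℂ) :
    tracePairing A 1 = A.trace.re := by
  rw [tracePairing_apply, Matrix.mul_one]

theorem trace_mul_nonneg {A B : Matrix n n ℂ} (hA : A.PosSemidef) (hB : B.PosSemidef) :
    0 ≤ (A * B).trace := by
  classical
  obtain ⟨C, rfl⟩ := CStarAlgebra.nonneg_iff_eq_star_mul_self.mp hA.nonneg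
  rw [Matrix.mul_assoc, trace_mul_comm]
  exact (hB.mul_mul_conjTranspose_same C).trace_nonneg

theorem tracePairing_nonneg {A B : Matrix n n ℂ} (hA : A.PosSemidef) (hB : B.PosSemidef) :
    0 ≤ tracePairing A B :=
  (Complex.nonneg_iff.1 (trace_mul_nonneg hA hB)).1

theorem tracePairing_le_of_le_left {A A' B : Matrix n n ℂ} (hA : A ≤ A') (hB : B.PosSemidef) :
    tracePairing A B ≤ tracePairing A' B := by
  simpa only [map_sub, LinearMap.sub_apply, sub_nonneg] using
    tracePairing_nonneg (Matrix.le_iff.1 hA) hB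

theorem trace_vecMulVec_mul (A : Matrix n n ℂ) (x y : n → ℂ) :
    (vecMulVec x y * A).trace = y ⬝ᵥ (A *ᵥ x) := by
  rw [trace_mul_comm, mul_vecMulVec, trace_vecMulVec, dotProduct_comm]

theorem posSemidef_of_dotProduct_mulVec_nonneg {A : Matrix n n ℂ}
    (h : ∀ x, 0 ≤ star x ⬝ᵥ (A *ᵥ x)) : A.PosSemidef := by
  classical
  rw [← isPositive_toEuclideanLin_iff, LinearMap.isPositive_iff_complex]
  intro x
  have inner_eq : inner ℂ (Matrix.toEuclideanLin A x) x = star x.ofLp ⬝ᵥ (A *ᵥ x.ofLp) := by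
    rw [EuclideanSpace.inner_eq_star_dotProduct, Matrix.ofLp_toLpLin, toLin'_apply,
      dotProduct_comm, star_dotProduct]
    exact (IsSelfAdjoint.of_nonneg (h _)).star_eq
  rw [inner_eq]
  exact ⟨Complex.ext rfl (Complex.nonneg_iff.1 (h x.ofLp)).2, (Complex.nonneg_iff.1 (h x.ofLp)).1⟩

theorem posSemidef_of_trace_mul_nonneg {B : Matrix n n ℂ}
    (h : ∀ A : Matrix n n ℂ, A.PosSemidef → 0 ≤ (A * B).trace) : B.PosSemidef :=
  posSemidef_of_dotProduct_mulVec_nonneg fun x => by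
    rw [← trace_vecMulVec_mul]
    exact h _ (posSemidef_vecMulVec_self_star x)

theorem exists_eq_trace_mul (f : Matrix n n ℂ →ₗ[ℂ] ℂ) :
    ∃ B : Matrix n n ℂ, ∀ A, f A = (A * B).trace := by
  classical
  refine ⟨Matrix.of fun j i => f (single i j 1), fun A => ?_⟩
  have expand : f A = ∑ i, ∑ j, A i j * f (single i j 1) := by
    conv_lhs => rw [matrix_eq_sum_single A]
    simp only [map_sum]
    refine Finset.sum_congr rfl fun _ _ => Finset.sum_congr rfl fun _ _ => ?_
    rw [← smul_eq_mul, ← map_smul, smul_single, smul_eq_mul, mul_one]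
  simpa only [trace, diag_apply, mul_apply, of_apply] using expand

end TracePairing

section Density

variable {n : Type*} [Fintype n]

theorem isDensity_normalised_vecMulVec {x : n → ℂ} (hx : x ≠ 0) :
    IsDensity ((star x ⬝ᵥ x).re⁻¹ • vecMulVec x (star x)) := by
  obtain ⟨re_pos, im_eq⟩ := Complex.pos_iff.1 (dotProduct_star_self_pos_iff.2 hx)
  have trace_eq : x ⬝ᵥ star x = ((star x ⬝ᵥ x).re : ℂ) := by
    rw [dotProduct_comm]
    exact Complex.ext rfl im_eq.symm
  refine ⟨(posSemidef_vecMulVec_self_star x).smul (inv_nonneg.2 re_pos.le), ?_⟩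
  rw [trace_smul, trace_vecMulVec, trace_eq, Complex.real_smul, ← Complex.ofReal_mul,
    inv_mul_cancel₀ re_pos.ne', Complex.ofReal_one]

theorem exists_isDensity [Nonempty n] : ∃ σ : Matrix n n ℂ, IsDensity σ :=
  ⟨_, isDensity_normalised_vecMulVec (one_ne_zero (α := n → ℂ))⟩

theorem IsDensity.nonempty {ρ : Matrix n n ℂ} (hρ : IsDensity ρ) : Nonempty n := by
  by_contra hn
  rw [not_nonempty_iff] at hn
  simpa using hρ.2

theorem posSemidef_of_tracePairing_isDensity_nonneg {H : Matrix n n ℂ} (hH : H.IsHermitian)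
    (h : ∀ ρ, IsDensity ρ → 0 ≤ tracePairing ρ H) : H.PosSemidef := by
  refine .of_dotProduct_mulVec_nonneg hH fun x => ?_
  rcases eq_or_ne x 0 with rfl | hx
  · simp
  refine Complex.nonneg_iff.2 ⟨?_, (hH.im_star_dotProduct_mulVec_self x).symm⟩
  have hpos := (Complex.pos_iff.1 (dotProduct_star_self_pos_iff.2 hx)).1
  simpa [tracePairing_apply, trace_vecMulVec_mul, hpos] using
    h _ (isDensity_normalised_vecMulVec hx)

theorem le_trace_smul_one [DecidableEq n] {A : Matrix n n ℂ} (hA : A.PosSemidef) :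
    A ≤ A.trace.re • (1 : Matrix n n ℂ) := by
  rw [← Algebra.algebraMap_eq_smul_one]
  refine le_algebraMap_of_spectrum_le (p := IsSelfAdjoint) ?_ hA.1
  rw [hA.1.spectrum_real_eq_range_eigenvalues, hA.1.trace_eq_sum_eigenvalues]
  rintro _ ⟨i, rfl⟩
  simpa using Finset.single_le_sum (fun j _ => hA.eigenvalues_nonneg j) (Finset.mem_univ i)

theorem convex_posSemidef {n : Type*} : Convex ℝ {A : Matrix n n ℂ | A.PosSemidef} :=
  fun _ hA _ hB _ _ ha hb _ => (PosSemidef.smul hA ha).add (PosSemidef.smul hB hb)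

theorem isClosed_posSemidef {n : Type*} [Finite n] :
    IsClosed {A : Matrix n n ℂ | A.PosSemidef} := by
  classical
  have := Fintype.ofFinite n
  simpa only [nonneg_iff_posSemidef] using CStarAlgebra.isClosed_nonneg (A := Matrix n n ℂ)

theorem isCompact_posSemidef_le_one {n : Type*} [Finite n] [DecidableEq n] :
    IsCompact {A : Matrix n n ℂ | A.PosSemidef ∧ A ≤ 1} := by
  have := Fintype.ofFinite n
  have : ProperSpace (Matrix n n ℂ) := FiniteDimensional.proper ℂ _
  refine (isCompact_closedBall (0 : Matrix n n ℂ) 1).of_isClosed_subset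
    (isClosed_posSemidef.inter isClosed_Iic) fun A hA => ?_
  rw [mem_closedBall_zero_iff]
  exact (CStarAlgebra.norm_le_one_iff_of_nonneg A hA.1.nonneg).2 hA.2

theorem isCompact_isDensity : IsCompact {ρ : Matrix n n ℂ | IsDensity ρ} := by
  classical
  refine isCompact_posSemidef_le_one.of_isClosed_subset
    (isClosed_posSemidef.inter (isClosed_eq continuous_id.matrix_trace continuous_const))
    fun ρ hρ => ⟨hρ.1, ?_⟩
  simpa [hρ.2] using le_trace_smul_one hρ.1

theorem convex_isDensity : Convex ℝ {ρ : Matrix n n ℂ | IsDensity ρ} := by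
  intro A hA B hB a b ha hb hab
  refine ⟨convex_posSemidef hA.1 hB.1 ha hb hab, ?_⟩
  rw [trace_add, trace_smul, trace_smul, hA.2, hB.2, ← add_smul, hab, one_smul]

theorem exists_isDensity_le_tracePairing_smul_one [DecidableEq n] [Nonempty n]
    {H : Matrix n n ℂ} (hH : H.IsHermitian) :
    ∃ ρ, IsDensity ρ ∧ H ≤ tracePairing ρ H • (1 : Matrix n n ℂ) := by
  obtain ⟨ρ, hρ, hmax⟩ := isCompact_isDensity.exists_isMaxOn (exists_isDensity (n := n))
    (tracePairing.flip H).continuous_of_finiteDimensional.continuousOn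
  refine ⟨ρ, hρ, Matrix.le_iff.2 (posSemidef_of_tracePairing_isDensity_nonneg ?_ ?_)⟩
  · exact (isHermitian_one.smul (IsSelfAdjoint.all _)).sub hH
  · intro ρ' hρ'
    simpa [tracePairing_one_right, hρ'.2] using hmax hρ'

end Density

section POVM

variable {U n : Type*} [Fintype U] [Fintype n] [DecidableEq n]

theorem IsPOVM.le_one {P : U → Matrix n n ℂ} (hP : IsPOVM P) (u : U) : P u ≤ 1 :=
  hP.2 ▸ Finset.single_le_sum (fun v _ => (hP.1 v).nonneg) (Finset.mem_univ u)

theorem isCompact_isPOVM : IsCompact {P : U → Matrix n n ℂ | IsPOVM P} := by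
  have effects_closed : IsClosed {P : U → Matrix n n ℂ | ∀ u, (P u).PosSemidef} := by
    rw [Set.ofPred_forall]
    exact isClosed_iInter fun u =>
      isClosed_posSemidef.preimage (f := fun P : U → Matrix n n ℂ => P u) (by fun_prop)
  exact (isCompact_univ_pi fun _ : U => isCompact_posSemidef_le_one (n := n)).of_isClosed_subset
    (effects_closed.inter (isClosed_eq (by fun_prop) continuous_const))
    fun P hP u _ => ⟨hP.1 u, hP.le_one u⟩

theorem convex_isPOVM : Convex ℝ {P : U → Matrix n n ℂ | IsPOVM P} := by
  intro P hP Q hQ a b ha hb hab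
  refine ⟨fun u => convex_posSemidef (hP.1 u) (hQ.1 u) ha hb hab, ?_⟩
  simp only [Pi.add_apply, Pi.smul_apply, Finset.sum_add_distrib, ← Finset.smul_sum, hP.2, hQ.2]
  rw [← add_smul, hab, one_smul]

theorem exists_isPOVM_ge [Nonempty U] {N : U → Matrix n n ℂ} (hN : ∀ u, (N u).PosSemidef)
    (hle : ∑ u, N u ≤ 1) : ∃ P, IsPOVM P ∧ ∀ u, N u ≤ P u := by
  have rest_nonneg : ((Fintype.card U : ℝ)⁻¹ • (1 - ∑ u, N u)).PosSemidef :=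
    (Matrix.le_iff.1 hle).smul (by positivity)
  refine ⟨fun u => N u + (Fintype.card U : ℝ)⁻¹ • (1 - ∑ u, N u),
    ⟨fun u => (hN u).add rest_nonneg, ?_⟩, fun u => le_add_of_nonneg_right rest_nonneg.nonneg⟩
  rw [Finset.sum_add_distrib, Finset.sum_const, Finset.card_univ, ← Nat.cast_smul_eq_nsmul ℝ,
    smul_inv_smul₀ (Nat.cast_ne_zero.2 Fintype.card_ne_zero), add_sub_cancel]

theorem isPOVM_uniform [Nonempty U] :
    IsPOVM fun _ : U => (Fintype.card U : ℝ)⁻¹ • (1 : Matrix n n ℂ) := by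
  refine ⟨fun _ => PosSemidef.one.smul (by positivity), ?_⟩
  rw [Finset.sum_const, Finset.card_univ, ← Nat.cast_smul_eq_nsmul ℝ,
    smul_inv_smul₀ (Nat.cast_ne_zero.2 Fintype.card_ne_zero)]

theorem bddAbove_guess (p : U → ℝ) (ρ : U → Matrix n n ℂ) :
    BddAbove {v : ℝ | ∃ P : U → Matrix n n ℂ, IsPOVM P ∧
      v = ∑ u, p u * ((ρ u * P u).trace).re} := by
  have guess_continuous : Continuous fun P : U → Matrix n n ℂ =>
      ∑ u, p u * tracePairing (ρ u) (P u) :=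
    continuous_finsetSum _ fun u _ => continuous_const.mul
      ((tracePairing (ρ u)).continuous_of_finiteDimensional.comp (continuous_apply u))
  refine (isCompact_isPOVM.image guess_continuous).bddAbove.mono ?_
  rintro v ⟨P, hP, rfl⟩
  exact ⟨P, hP, rfl⟩

theorem le_guessProb (p : U → ℝ) (ρ : U → Matrix n n ℂ) {P : U → Matrix n n ℂ} (hP : IsPOVM P) :
    ∑ u, p u * tracePairing (ρ u) (P u) ≤ guessProb p ρ :=
  le_csSup (bddAbove_guess p ρ) ⟨P, hP, rfl⟩

theorem guessProb_le [Nonempty U] {p : U → ℝ} {ρ : U → Matrix n n ℂ} {r : ℝ}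
    (h : ∀ P, IsPOVM P → ∑ u, p u * tracePairing (ρ u) (P u) ≤ r) : guessProb p ρ ≤ r := by
  refine csSup_le ⟨_, _, isPOVM_uniform, rfl⟩ ?_
  rintro v ⟨P, hP, rfl⟩
  exact h P hP

theorem nonempty_of_mem_stdSimplex {p : U → ℝ} (hp : p ∈ stdSimplex ℝ U) : Nonempty U := by
  by_contra hU
  rw [not_nonempty_iff] at hU
  simpa using hp.2

theorem guessProb_pos {p : U → ℝ} (hp : p ∈ stdSimplex ℝ U) {ρ : U → Matrix n n ℂ}
    (hρ : ∀ u, IsDensity (ρ u)) : 0 < guessProb p ρ := by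
  have := nonempty_of_mem_stdSimplex hp
  calc (0 : ℝ) < (Fintype.card U : ℝ)⁻¹ := by positivity
    _ = ∑ u, p u * tracePairing (ρ u) ((Fintype.card U : ℝ)⁻¹ • 1) := by
      simp only [map_smul, tracePairing_one_right, (hρ _).2, Complex.one_re, smul_eq_mul, mul_one]
      rw [← Finset.sum_mul, hp.2, one_mul]
    _ ≤ guessProb p ρ := le_guessProb p ρ isPOVM_uniform

end POVM

section PartialTrace

variable {k n : Type*} [Fintype k]

/-- The partial trace over the first tensor factor, as the sum of the diagonal blocks. -/
def partialTrace (B : Matrix (k × n) (k × n) ℂ) : Matrix n n ℂ :=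
  ∑ u, B.submatrix (Prod.mk u) (Prod.mk u)

theorem trace_partialTrace [Fintype n] (B : Matrix (k × n) (k × n) ℂ) :
    (partialTrace B).trace = B.trace := by
  rw [partialTrace, trace_sum]
  simp only [trace, diag_apply, submatrix_apply, Fintype.sum_prod_type]

theorem partialTrace_smul (r : ℝ) (B : Matrix (k × n) (k × n) ℂ) :
    partialTrace (r • B) = r • partialTrace B := by
  simp only [partialTrace, submatrix_smul, Pi.smul_apply, Finset.smul_sum]

theorem posSemidef_partialTrace {B : Matrix (k × n) (k × n) ℂ} (hB : B.PosSemidef) :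
    (partialTrace B).PosSemidef :=
  posSemidef_sum _ fun _ _ => hB.submatrix _

theorem trace_single_kronecker_mul [Fintype n] [DecidableEq k] (i j : k) (A : Matrix n n ℂ)
    (B : Matrix (k × n) (k × n) ℂ) :
    ((single i j 1 ⊗ₖ A) * B).trace = (A * B.submatrix (Prod.mk j) (Prod.mk i)).trace := by
  simp only [trace, diag_apply, mul_apply, Fintype.sum_prod_type, kroneckerMap_apply,
    submatrix_apply, single_apply, ite_and, ite_mul, one_mul, zero_mul]
  rw [Finset.sum_eq_single_of_mem i (Finset.mem_univ i) fun a _ ha => by simp [ha.symm]]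
  simp

theorem one_kronecker_eq_sum [DecidableEq k] (A : Matrix n n ℂ) :
    (1 : Matrix k k ℂ) ⊗ₖ A = ∑ u, single u u 1 ⊗ₖ A := by
  rw [← sum_single_one]
  exact LinearMap.map_sum₂ (kroneckerBilinear (R := ℂ)) _ _ A

theorem tracePairing_one_kronecker [Fintype n] [DecidableEq k] (A : Matrix n n ℂ)
    (B : Matrix (k × n) (k × n) ℂ) :
    tracePairing ((1 : Matrix k k ℂ) ⊗ₖ A) B = tracePairing A (partialTrace B) := by
  simp only [one_kronecker_eq_sum, partialTrace, map_sum, LinearMap.sum_apply, tracePairing_apply,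
    trace_single_kronecker_mul]

end PartialTrace

section MinEntropyDuality

variable {k n : Type*} [Fintype k] [DecidableEq k] [Fintype n]

theorem tracePairing_sub_smul_one_kronecker (A B : Matrix (k × n) (k × n) ℂ) (v : ℝ)
    (σ : Matrix n n ℂ) :
    tracePairing (A - v • ((1 : Matrix k k ℂ) ⊗ₖ σ)) B =
      tracePairing A B - v * tracePairing σ (partialTrace B) := by
  rw [map_sub, map_smul, LinearMap.sub_apply, LinearMap.smul_apply, tracePairing_one_kronecker,
    smul_eq_mul]

variable [DecidableEq n]

theorem exists_isDensity_tracePairing_sub_nonpos {A : Matrix (k × n) (k × n) ℂ} {v : ℝ}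
    (hv : ∀ B : Matrix (k × n) (k × n) ℂ, B.PosSemidef → partialTrace B ≤ 1 → tracePairing A B ≤ v)
    {B : Matrix (k × n) (k × n) ℂ} (hB : IsDensity B) :
    ∃ σ, IsDensity σ ∧ tracePairing (A - v • ((1 : Matrix k k ℂ) ⊗ₖ σ)) B ≤ 0 := by
  have marginal_density : IsDensity (partialTrace B) :=
    ⟨posSemidef_partialTrace hB.1, (trace_partialTrace B).trans hB.2⟩
  have := marginal_density.nonempty
  obtain ⟨σ, hσ, hle⟩ := exists_isDensity_le_tracePairing_smul_one marginal_density.1.1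
  set μ := tracePairing σ (partialTrace B)
  have μ_pos : 0 < μ := by
    have := tracePairing_le_of_le_left hle (B := 1) PosSemidef.one
    simp only [map_smul, LinearMap.smul_apply, tracePairing_one_right, marginal_density.2,
      trace_one, Complex.one_re, Complex.natCast_re, smul_eq_mul] at this
    exact pos_of_mul_pos_left (one_pos.trans_le this) (Nat.cast_nonneg _)
  refine ⟨σ, hσ, ?_⟩
  have feasible : partialTrace (μ⁻¹ • B) ≤ 1 := by
    rw [partialTrace_smul]
    exact (inv_smul_le_iff_of_pos μ_pos).2 hle
  have := hv _ (hB.1.smul (inv_nonneg.2 μ_pos.le)) feasible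
  rw [map_smul, smul_eq_mul, inv_mul_le_iff₀ μ_pos, mul_comm] at this
  rw [tracePairing_sub_smul_one_kronecker]
  exact sub_nonpos.2 this

/-- The optimal `σ` and `B` form a saddle point of the Lagrangian `Re Tr[(A - v (1 ⊗ σ)) B]`. -/
theorem exists_isDensity_le_smul_one_kronecker [Nonempty k] [Nonempty n]
    {A : Matrix (k × n) (k × n) ℂ} (hA : A.IsHermitian) {v : ℝ}
    (hv : ∀ B : Matrix (k × n) (k × n) ℂ, B.PosSemidef → partialTrace B ≤ 1 →
      tracePairing A B ≤ v) :
    ∃ σ, IsDensity σ ∧ A ≤ v • ((1 : Matrix k k ℂ) ⊗ₖ σ) := by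
  obtain ⟨σ, hσ, B, hB, saddle⟩ := Sion.exists_isSaddlePointOn
    (X := {σ : Matrix n n ℂ | IsDensity σ}) (Y := {B : Matrix (k × n) (k × n) ℂ | IsDensity B})
    (f := fun σ B => tracePairing (A - v • ((1 : Matrix k k ℂ) ⊗ₖ σ)) B)
    exists_isDensity convex_isDensity isCompact_isDensity
    (fun B _ => by
      simp only [tracePairing_sub_smul_one_kronecker]
      exact (continuous_const.sub ((v • tracePairing.flip
        (partialTrace B)).continuous_of_finiteDimensional)).lowerSemicontinuous
          |>.lowerSemicontinuousOn _)
    (fun B _ => by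
      simp only [tracePairing_sub_smul_one_kronecker]
      exact ((convexOn_const _ convex_isDensity).sub
        ((v • tracePairing.flip (partialTrace B)).concaveOn convex_isDensity)).quasiconvexOn)
    convex_isDensity exists_isDensity isCompact_isDensity
    (fun σ _ => (tracePairing _).continuous_of_finiteDimensional.upperSemicontinuous
      |>.upperSemicontinuousOn _)
    (fun σ _ => ((tracePairing _).concaveOn convex_isDensity).quasiconcaveOn)
  obtain ⟨σ₀, hσ₀, hle⟩ := exists_isDensity_tracePairing_sub_nonpos hv hB
  refine ⟨σ, hσ, Matrix.le_iff.2 (posSemidef_of_tracePairing_isDensity_nonneg ?_ fun B' hB' => ?_)⟩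
  · exact (((PosSemidef.one.kronecker hσ.1).1).smul (IsSelfAdjoint.all v)).sub hA
  · have := (saddle σ₀ hσ₀ B' hB').trans hle
    rw [tracePairing_comm, ← neg_sub, map_neg, LinearMap.neg_apply]
    exact neg_nonneg.2 this

end MinEntropyDuality

section MinEntropyOfCQState

variable {U n : Type*} [Fintype U] [DecidableEq U]

theorem cqState_submatrix (p : U → ℝ) (ρ : U → Matrix n n ℂ) (u : U) :
    (cqState p ρ).submatrix (Prod.mk u) (Prod.mk u) = p u • ρ u := by
  ext i j
  simp only [cqState, submatrix_apply, Matrix.sum_apply, Matrix.smul_apply, kroneckerMap_apply,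
    single_apply, and_self, ite_mul, one_mul, zero_mul, smul_ite, smul_zero, Finset.sum_ite_eq',
    Finset.mem_univ, if_true]

theorem partialTrace_cqState (p : U → ℝ) (ρ : U → Matrix n n ℂ) :
    partialTrace (cqState p ρ) = ∑ u, p u • ρ u := by
  simp only [partialTrace, cqState_submatrix]

theorem posSemidef_cqState [Finite n] {p : U → ℝ} (hp : ∀ u, 0 ≤ p u) {ρ : U → Matrix n n ℂ}
    (hρ : ∀ u, (ρ u).PosSemidef) : (cqState p ρ).PosSemidef := by
  refine posSemidef_sum _ fun u _ => PosSemidef.smul (.kronecker ?_ (hρ u)) (hp u)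
  rw [← diagonal_single]
  exact PosSemidef.diagonal (Pi.single_nonneg.2 zero_le_one)

theorem tracePairing_cqState [Fintype n] (p : U → ℝ) (ρ : U → Matrix n n ℂ)
    (B : Matrix (U × n) (U × n) ℂ) :
    tracePairing (cqState p ρ) B =
      ∑ u, p u * tracePairing (ρ u) (B.submatrix (Prod.mk u) (Prod.mk u)) := by
  simp only [cqState, map_sum, map_smul, LinearMap.sum_apply, LinearMap.smul_apply,
    tracePairing_apply, trace_single_kronecker_mul, smul_eq_mul]

variable [Fintype n] [DecidableEq n]

theorem tracePairing_cqState_le_guessProb [Nonempty U] {p : U → ℝ} (hp : ∀ u, 0 ≤ p u)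
    {ρ : U → Matrix n n ℂ} (hρ : ∀ u, (ρ u).PosSemidef) {B : Matrix (U × n) (U × n) ℂ}
    (hB : B.PosSemidef) (hle : partialTrace B ≤ 1) :
    tracePairing (cqState p ρ) B ≤ guessProb p ρ := by
  obtain ⟨P, hP, block_le⟩ := exists_isPOVM_ge (fun u => hB.submatrix (Prod.mk u)) hle
  rw [tracePairing_cqState]
  refine le_trans (Finset.sum_le_sum fun u _ => mul_le_mul_of_nonneg_left ?_ (hp u))
    (le_guessProb p ρ hP)
  rw [tracePairing_comm, tracePairing_comm (ρ u)]
  exact tracePairing_le_of_le_left (block_le u) (hρ u)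

theorem guessProb_le_of_cqState_le [Nonempty U] {p : U → ℝ} {ρ : U → Matrix n n ℂ} {v : ℝ}
    {σ : Matrix n n ℂ} (hσ : IsDensity σ)
    (hle : cqState p ρ ≤ v • ((1 : Matrix U U ℂ) ⊗ₖ σ)) : guessProb p ρ ≤ v := by
  refine guessProb_le fun P hP => ?_
  have partialTrace_eq_one : partialTrace (cqState (fun _ => 1) P) = 1 := by
    simp only [partialTrace_cqState, one_smul, hP.2]
  calc ∑ u, p u * tracePairing (ρ u) (P u)
      = tracePairing (cqState p ρ) (cqState (fun _ => 1) P) := by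
        simp only [tracePairing_cqState, cqState_submatrix, one_smul]
    _ ≤ tracePairing (v • ((1 : Matrix U U ℂ) ⊗ₖ σ)) (cqState (fun _ => 1) P) :=
        tracePairing_le_of_le_left hle (posSemidef_cqState (fun _ => zero_le_one) hP.1)
    _ = v := by
        rw [map_smul, LinearMap.smul_apply, tracePairing_one_kronecker, partialTrace_eq_one,
          tracePairing_one_right, hσ.2, Complex.one_re, smul_eq_mul, mul_one]

theorem Hmin_cqState {p : U → ℝ} (hp : p ∈ stdSimplex ℝ U) {ρ : U → Matrix n n ℂ}
    (hρ : ∀ u, IsDensity (ρ u)) : Hmin (cqState p ρ) = -Real.logb 2 (guessProb p ρ) := by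
  have := nonempty_of_mem_stdSimplex hp
  have := (hρ (Classical.arbitrary U)).nonempty
  have guess_pos := guessProb_pos hp hρ
  refine congrArg Neg.neg (IsLeast.csInf_eq ⟨?_, ?_⟩)
  · simp only [Set.mem_ofPred_eq, Real.rpow_logb two_pos (by norm_num) guess_pos]
    exact exists_isDensity_le_smul_one_kronecker (posSemidef_cqState hp.1 fun u => (hρ u).1).1
      fun B => tracePairing_cqState_le_guessProb hp.1 fun u => (hρ u).1
  · rintro l ⟨σ, hσ, hle⟩
    exact (Real.logb_le_iff_le_rpow one_lt_two guess_pos).2 (guessProb_le_of_cqState_le hσ hle)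

theorem Hmin_cqState_le_Hmin_cqState_iff {m : Type*} [Fintype m] [DecidableEq m] {p : U → ℝ}
    (hp : p ∈ stdSimplex ℝ U) {ρ : U → Matrix n n ℂ} {ρ' : U → Matrix m m ℂ}
    (hρ : ∀ u, IsDensity (ρ u)) (hρ' : ∀ u, IsDensity (ρ' u)) :
    Hmin (cqState p ρ) ≤ Hmin (cqState p ρ') ↔ guessProb p ρ' ≤ guessProb p ρ := by
  rw [Hmin_cqState hp hρ, Hmin_cqState hp hρ', neg_le_neg_iff,
    Real.logb_le_logb one_lt_two (guessProb_pos hp hρ') (guessProb_pos hp hρ)]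

end MinEntropyOfCQState

section Mixture

variable {X Y m n : Type*} [Fintype X] [Fintype Y]

theorem mixture_eq_sum (c : Y × X → ℝ) (ω : Y → Matrix m m ℂ) (σ : X → Matrix n n ℂ) :
    mixture c ω σ = ∑ z, c z • (ω z.1 ⊗ₖ σ z.2) := by
  rw [Fintype.sum_prod_type, mixture]

theorem isDensity_mixture [Fintype m] [Fintype n] {c : Y × X → ℝ}
    (hc : c ∈ stdSimplex ℝ (Y × X)) {ω : Y → Matrix m m ℂ} {σ : X → Matrix n n ℂ}
    (hω : ∀ y, IsDensity (ω y)) (hσ : ∀ x, IsDensity (σ x)) : IsDensity (mixture c ω σ) := by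
  rw [mixture_eq_sum]
  refine convex_isDensity.sum_mem (fun z _ => hc.1 z) hc.2 fun z _ =>
    ⟨(hω z.1).1.kronecker (hσ z.2).1, ?_⟩
  rw [trace_kronecker, (hω _).2, (hσ _).2, one_mul]

end Mixture

section DataProcessing

variable {U m n : Type*} [Fintype U] [Fintype m] [Fintype n]

theorem exists_trace_mul_eq_trace_map_mul (Φ : Matrix m m ℂ →ₗ[ℂ] Matrix n n ℂ)
    (B : Matrix n n ℂ) : ∃ C, ∀ A, (A * C).trace = (Φ A * B).trace := by
  obtain ⟨C, hC⟩ := exists_eq_trace_mul (traceLinearMap n ℂ ℂ ∘ₗ LinearMap.mulRight ℂ B ∘ₗ Φ)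
  exact ⟨C, fun A => (hC A).symm⟩

variable [DecidableEq m] [DecidableEq n]

theorem exists_isPOVM_trace_mul_eq {Φ : Matrix m m ℂ →ₗ[ℂ] Matrix n n ℂ}
    (Φ_pos : ∀ A, A.PosSemidef → (Φ A).PosSemidef) (Φ_trace : ∀ A, (Φ A).trace = A.trace)
    {P : U → Matrix n n ℂ} (hP : IsPOVM P) :
    ∃ Q : U → Matrix m m ℂ, IsPOVM Q ∧ ∀ u A, (A * Q u).trace = (Φ A * P u).trace := by
  choose Q hQ using fun u => exists_trace_mul_eq_trace_map_mul Φ (P u)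
  refine ⟨Q, ⟨fun u => posSemidef_of_trace_mul_nonneg fun A hA => ?_,
    Matrix.ext_iff_trace_mul_left.2 fun A => ?_⟩, hQ⟩
  · rw [hQ]
    exact trace_mul_nonneg (Φ_pos A hA) (hP.1 u)
  · simp only [Finset.mul_sum, trace_sum, hQ]
    rw [← trace_sum, ← Finset.mul_sum, hP.2, Matrix.mul_one, Matrix.mul_one, Φ_trace]

theorem guessProb_map_le [Nonempty U] {Φ : Matrix m m ℂ →ₗ[ℂ] Matrix n n ℂ}
    (Φ_pos : ∀ A, A.PosSemidef → (Φ A).PosSemidef) (Φ_trace : ∀ A, (Φ A).trace = A.trace)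
    (q : U → ℝ) (ρ : U → Matrix m m ℂ) : guessProb q (fun u => Φ (ρ u)) ≤ guessProb q ρ := by
  refine guessProb_le fun P hP => ?_
  obtain ⟨Q, hQ, pullback⟩ := exists_isPOVM_trace_mul_eq Φ_pos Φ_trace hP
  simpa only [tracePairing_apply, pullback] using le_guessProb q ρ hQ

end DataProcessing

section Ampliation

variable {k m n : Type*}

/-- The map `id ⊗ T` on `k × k` block matrices, which applies `T` to every block. -/
def ampliation (k : Type*) (T : Matrix m m ℂ →ₗ[ℂ] Matrix n n ℂ) :
    Matrix (k × m) (k × m) ℂ →ₗ[ℂ] Matrix (k × n) (k × n) ℂ :=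
  (compLinearEquiv k k n n ℂ ℂ).toLinearMap ∘ₗ T.mapMatrix ∘ₗ
    (compLinearEquiv k k m m ℂ ℂ).symm.toLinearMap

theorem ampliation_apply (T : Matrix m m ℂ →ₗ[ℂ] Matrix n n ℂ) (A : Matrix (k × m) (k × m) ℂ)
    (a b : k × n) :
    ampliation k T A a b = T (A.submatrix (Prod.mk a.1) (Prod.mk b.1)) a.2 b.2 := rfl

theorem ampliation_kronecker (T : Matrix m m ℂ →ₗ[ℂ] Matrix n n ℂ) (W : Matrix k k ℂ)
    (A : Matrix m m ℂ) : ampliation k T (W ⊗ₖ A) = W ⊗ₖ T A := by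
  ext a b
  have block : (W ⊗ₖ A).submatrix (Prod.mk a.1) (Prod.mk b.1) = W a.1 b.1 • A := rfl
  rw [ampliation_apply, block, map_smul, Matrix.smul_apply, smul_eq_mul, kroneckerMap_apply]

theorem ampliation_mixture {X Y : Type*} [Fintype X] [Fintype Y]
    (T : Matrix m m ℂ →ₗ[ℂ] Matrix n n ℂ) (c : Y × X → ℝ) (ω : Y → Matrix k k ℂ)
    (σ : X → Matrix m m ℂ) :
    ampliation k T (mixture c ω σ) = mixture c ω fun x => T (σ x) := by
  simp only [mixture, map_sum, LinearMap.map_smul_of_tower, ampliation_kronecker]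

variable [Fintype k] [Fintype m] [Fintype n]

theorem trace_ampliation {T : Matrix m m ℂ →ₗ[ℂ] Matrix n n ℂ}
    (T_trace : ∀ A, (T A).trace = A.trace) (A : Matrix (k × m) (k × m) ℂ) :
    (ampliation k T A).trace = A.trace := by
  have partialTrace_ampliation : partialTrace (ampliation k T A) = T (partialTrace A) := by
    rw [partialTrace, partialTrace, map_sum]
    rfl
  rw [← trace_partialTrace, partialTrace_ampliation, T_trace, trace_partialTrace]

variable [DecidableEq m] [DecidableEq n]

/-- Flattening of a matrix with matrix entries, a `*`-isomorphism onto the block matrices. -/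
def flatten (k m : Type*) [Fintype k] [Fintype m] [DecidableEq m] :
    CStarMatrix k k (Matrix m m ℂ) ≃⋆+* Matrix (k × m) (k × m) ℂ where
  __ := CStarMatrix.ofMatrixRingEquiv.symm.trans (compRingEquiv k m ℂ)
  map_star' _ := rfl

theorem flatten_map (T : Matrix m m ℂ →ₗ[ℂ] Matrix n n ℂ) (M : CStarMatrix k k (Matrix m m ℂ)) :
    flatten k n (M.map T) = ampliation k T (flatten k m M) := rfl

theorem posSemidef_ampliation {k : Type*} [Finite k] (T : Matrix m m ℂ →CP Matrix n n ℂ)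
    {A : Matrix (k × m) (k × m) ℂ} (hA : A.PosSemidef) :
    (ampliation k T.toLinearMap A).PosSemidef := by
  classical
  have := Fintype.ofFinite k
  have blocks_nonneg : 0 ≤ (flatten k m).symm A := map_nonneg (flatten k m).symm hA.nonneg
  rw [← (flatten k m).apply_symm_apply A, ← flatten_map]
  exact (map_nonneg (flatten k n) (T.map_cstarMatrix_nonneg _ blocks_nonneg)).posSemidef

theorem guessProb_mixture_map_le {U X Y : Type*} [Fintype U] [Nonempty U] [Fintype X] [Fintype Y]
    [DecidableEq k] (T : Matrix m m ℂ →CP Matrix n n ℂ) (T_trace : ∀ A, (T A).trace = A.trace)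
    (q : U → ℝ) (c : U → Y × X → ℝ) (ω : Y → Matrix k k ℂ) (σ : X → Matrix m m ℂ) :
    guessProb q (fun u => mixture (c u) ω fun x => T (σ x)) ≤
      guessProb q (fun u => mixture (c u) ω σ) := by
  have monotone := guessProb_map_le (fun A => posSemidef_ampliation T) (trace_ampliation T_trace) q
    fun u => mixture (c u) ω σ
  simp only [ampliation_mixture] at monotone
  exact monotone

end Ampliation

section SupportFunction

variable {ι : Type*} [Fintype ι] [Nonempty ι]

theorem exists_stdSimplex_affine (a : ι → ℝ) :
    ∃ w ∈ stdSimplex ℝ ι, ∃ r > 0, ∃ s, ∀ i, w i = r * (a i + s) := by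
  obtain ⟨s, hs⟩ : ∃ s, ∀ i, 0 < a i + s := by
    obtain ⟨b, hb⟩ := (Set.finite_range a).bddBelow
    exact ⟨1 - b, fun i => by linarith [hb ⟨i, rfl⟩]⟩
  have sum_pos : 0 < ∑ i, (a i + s) := Finset.sum_pos (fun i _ => hs i) Finset.univ_nonempty
  refine ⟨fun i => (∑ i, (a i + s))⁻¹ * (a i + s),
    ⟨fun i => mul_nonneg (inv_nonneg.2 sum_pos.le) (hs i).le, ?_⟩,
    (∑ i, (a i + s))⁻¹, inv_pos.2 sum_pos, s, fun i => rfl⟩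
  rw [← Finset.mul_sum, inv_mul_cancel₀ sum_pos.ne']

/-- On a hyperplane `∑ i, y i = s` every linear functional is an increasing affine function of a
probability vector, so separation by probability vectors is as strong as Hahn–Banach. -/
theorem mem_of_forall_stdSimplex_le {K : Set (ι → ℝ)} (hconv : Convex ℝ K) (hclosed : IsClosed K)
    {x : ι → ℝ} (hsum : ∀ y ∈ K, ∑ i, y i = ∑ i, x i)
    (hle : ∀ w ∈ stdSimplex ℝ ι, ∀ r, (∀ y ∈ K, w ⬝ᵥ y ≤ r) → w ⬝ᵥ x ≤ r) : x ∈ K := by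
  classical
  by_contra hx
  obtain ⟨f, r, hr, hrx⟩ := geometric_hahn_banach_closed_point hconv hclosed hx
  obtain ⟨w, hw, N, hN, s, hws⟩ := exists_stdSimplex_affine fun i => f (Pi.single i 1)
  have dotProduct_eq (y : ι → ℝ) : w ⬝ᵥ y = N * (f y + s * ∑ i, y i) := by
    have f_eq : f y = ∑ i, f (Pi.single i 1) * y i := by
      conv_lhs => rw [← Finset.univ_sum_single y, map_sum]
      refine Finset.sum_congr rfl fun i _ => ?_
      rw [mul_comm, ← smul_eq_mul, ← map_smul, ← Pi.single_smul, smul_eq_mul, mul_one]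
    simp only [dotProduct, hws, f_eq, mul_assoc, add_mul, ← Finset.mul_sum,
      Finset.sum_add_distrib]
  have x_le := hle w hw (N * (r + s * ∑ i, x i)) fun y hy => by
    rw [dotProduct_eq, hsum y hy]
    gcongr
    exact (hr y hy).le
  rw [dotProduct_eq, mul_le_mul_iff_right₀ hN, add_le_add_iff_right] at x_le
  exact hrx.not_ge x_le

end SupportFunction

section ChainRule

variable {U Z : Type*} [Fintype U] [Fintype Z] [Nonempty Z]

theorem exists_marginal_conditional {w : U × Z → ℝ} (hw : w ∈ stdSimplex ℝ (U × Z)) :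
    ∃ q ∈ stdSimplex ℝ U, ∃ c : U → Z → ℝ, (∀ u, c u ∈ stdSimplex ℝ Z) ∧
      ∀ u z, w (u, z) = q u * c u z := by
  classical
  have exists_conditional (u : U) :
      ∃ c ∈ stdSimplex ℝ Z, ∀ z, w (u, z) = (∑ z, w (u, z)) * c z := by
    rcases eq_or_ne (∑ z, w (u, z)) 0 with hu | hu
    · refine ⟨_, single_mem_stdSimplex ℝ (Classical.arbitrary Z), fun z => ?_⟩
      rw [hu, zero_mul]
      exact (Finset.sum_eq_zero_iff_of_nonneg fun z _ => hw.1 (u, z)).1 hu z (Finset.mem_univ z)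
    · refine ⟨fun z => w (u, z) / ∑ z, w (u, z), ⟨fun z => ?_, ?_⟩, fun z => ?_⟩
      · exact div_nonneg (hw.1 _) (Finset.sum_nonneg fun z _ => hw.1 _)
      · rw [← Finset.sum_div, div_self hu]
      · rw [mul_div_cancel₀ _ hu]
  choose c hc hwc using exists_conditional
  refine ⟨fun u => ∑ z, w (u, z), ⟨fun u => Finset.sum_nonneg fun z _ => hw.1 _, ?_⟩, c, hc, hwc⟩
  rw [← Fintype.sum_prod_type, hw.2]

end ChainRule

section Statistics

variable {U Z m n : Type*} [Fintype m] [Fintype n]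

/-- The statistics `Re Tr[ρ z * P u]` of the measurement operators `P` on the states `ρ`. -/
noncomputable def statistics (ρ : Z → Matrix m m ℂ) : (U → Matrix m m ℂ) →ₗ[ℝ] (U × Z → ℝ) :=
  LinearMap.pi fun t => tracePairing (ρ t.2) ∘ₗ LinearMap.proj t.1

theorem statistics_apply (ρ : Z → Matrix m m ℂ) (P : U → Matrix m m ℂ) (u : U) (z : Z) :
    statistics ρ P (u, z) = tracePairing (ρ z) (P u) := rfl

variable [Fintype U] [Fintype Z]

theorem sum_guess_eq_dotProduct_statistics {q : U → ℝ} {c : U → Z → ℝ} {w : U × Z → ℝ}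
    (hw : ∀ u z, w (u, z) = q u * c u z) (ρ : Z → Matrix m m ℂ) (P : U → Matrix m m ℂ) :
    ∑ u, q u * tracePairing (∑ z, c u z • ρ z) (P u) = w ⬝ᵥ statistics ρ P := by
  simp only [dotProduct, Fintype.sum_prod_type, hw, statistics_apply, map_sum, map_smul,
    LinearMap.sum_apply, LinearMap.smul_apply, smul_eq_mul, Finset.mul_sum, mul_assoc]

variable [DecidableEq m] [DecidableEq n]

theorem IsPOVM.sum_statistics {P : U → Matrix m m ℂ} (hP : IsPOVM P) (ρ : Z → Matrix m m ℂ) :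
    ∑ t, statistics ρ P t = ∑ z, (ρ z).trace.re := by
  simp only [Fintype.sum_prod_type_right, statistics_apply, ← map_sum, hP.2,
    tracePairing_one_right]

/-- Minimax: a strategy matching `P` in every guessing game may depend on the game, but by
convexity of the set of achievable statistics a single one matches `P` in all of them. -/
theorem exists_isPOVM_statistics_eq [Nonempty U] {ρ : Z → Matrix m m ℂ} {ρ' : Z → Matrix n n ℂ}
    (htrace : ∀ z, (ρ z).trace = (ρ' z).trace)
    (hguess : ∀ (q : U → ℝ) (c : U → Z → ℝ), q ∈ stdSimplex ℝ U →
      (∀ u, c u ∈ stdSimplex ℝ Z) →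
      guessProb q (fun u => ∑ z, c u z • ρ' z) ≤ guessProb q (fun u => ∑ z, c u z • ρ z))
    {P : U → Matrix n n ℂ} (hP : IsPOVM P) :
    ∃ Q : U → Matrix m m ℂ, IsPOVM Q ∧ statistics ρ Q = statistics ρ' P := by
  rcases isEmpty_or_nonempty Z with hZ | hZ
  · exact ⟨_, isPOVM_uniform, funext fun t => hZ.elim t.2⟩
  refine mem_of_forall_stdSimplex_le (convex_isPOVM.linear_image (statistics ρ))
    (isCompact_isPOVM.image (statistics ρ).continuous_of_finiteDimensional).isClosed ?_
    fun w hw r hr => ?_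
  · rintro _ ⟨Q, hQ, rfl⟩
    simp only [hP.sum_statistics, IsPOVM.sum_statistics hQ, htrace]
  · obtain ⟨q, hq, c, hc, hwc⟩ := exists_marginal_conditional hw
    rw [← sum_guess_eq_dotProduct_statistics hwc]
    calc ∑ u, q u * tracePairing (∑ z, c u z • ρ' z) (P u)
        ≤ guessProb q (fun u => ∑ z, c u z • ρ' z) := le_guessProb q _ hP
      _ ≤ guessProb q (fun u => ∑ z, c u z • ρ z) := hguess q c hq hc
      _ ≤ r := guessProb_le fun Q hQ => by
        rw [sum_guess_eq_dotProduct_statistics hwc]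
        exact hr _ ⟨Q, hQ, rfl⟩

end Statistics

section Span

variable {Y k m n : Type*} [Fintype k] [Fintype m] [Fintype n]

/-- Against positive operators the pairing already determines the complex trace. -/
theorem trace_kronecker_mul_eq_of_span_eq_top {ω : Y → Matrix k k ℂ} (hω : ∀ y, (ω y).PosSemidef)
    (hspan : Submodule.span ℂ (Set.range ω) = ⊤) {A : Matrix m m ℂ} {A' : Matrix n n ℂ}
    (hA : A.PosSemidef) (hA' : A'.PosSemidef) {Q : Matrix (k × m) (k × m) ℂ}
    {P : Matrix (k × n) (k × n) ℂ} (hQ : Q.PosSemidef) (hP : P.PosSemidef)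
    (h : ∀ y, tracePairing (ω y ⊗ₖ A) Q = tracePairing (ω y ⊗ₖ A') P) (W : Matrix k k ℂ) :
    ((W ⊗ₖ A) * Q).trace = ((W ⊗ₖ A') * P).trace := by
  have hW : W ∈ Submodule.span ℂ (Set.range ω) := hspan ▸ Submodule.mem_top
  induction hW using Submodule.span_induction with
  | mem W hW =>
    obtain ⟨y, rfl⟩ := hW
    have hQ' := Complex.nonneg_iff.1 (trace_mul_nonneg ((hω y).kronecker hA) hQ)
    have hP' := Complex.nonneg_iff.1 (trace_mul_nonneg ((hω y).kronecker hA') hP)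
    exact Complex.ext (h y) (hQ'.2.symm.trans hP'.2)
  | zero => simp only [zero_kronecker, Matrix.zero_mul, trace_zero]
  | add V W _ _ hV hW => simp only [add_kronecker, Matrix.add_mul, trace_add, hV, hW]
  | smul r W _ hW => simp only [smul_kronecker, smul_mul, trace_smul, hW]

end Span

section Kraus

variable {ι m n : Type*} [Fintype ι] [Fintype m]

/-- The linear map with Kraus operators `K`, before its complete positivity is established. -/
noncomputable def krausLinearMap (K : ι → Matrix n m ℂ) : Matrix m m ℂ →ₗ[ℂ] Matrix n n ℂ where
  toFun A := ∑ i, K i * A * (K i)ᴴ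
  map_add' A B := by simp only [Matrix.mul_add, Matrix.add_mul, Finset.sum_add_distrib]
  map_smul' c A := by
    simp only [Matrix.mul_smul, Matrix.smul_mul, Finset.smul_sum, RingHom.id_apply]

theorem krausLinearMap_apply (K : ι → Matrix n m ℂ) (A : Matrix m m ℂ) :
    krausLinearMap K A = ∑ i, K i * A * (K i)ᴴ := rfl

theorem ampliation_krausLinearMap {k : Type*} [Fintype k] [DecidableEq k] (K : ι → Matrix n m ℂ) :
    ampliation k (krausLinearMap K) =
      krausLinearMap fun i => (1 : Matrix k k ℂ) ⊗ₖ K i := by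
  ext A a b
  simp [ampliation_apply, krausLinearMap_apply, Matrix.sum_apply, Matrix.mul_apply,
    Fintype.sum_prod_type, one_apply, Finset.sum_mul, apply_ite]

theorem posSemidef_krausLinearMap [Finite n] (K : ι → Matrix n m ℂ) {A : Matrix m m ℂ}
    (hA : A.PosSemidef) : (krausLinearMap K A).PosSemidef :=
  posSemidef_sum _ fun i _ => hA.mul_mul_conjTranspose_same (K i)

/-- The completely positive map with Kraus operators `K`. -/
noncomputable def krausMap [Fintype n] [DecidableEq m] [DecidableEq n] (K : ι → Matrix n m ℂ) :
    Matrix m m ℂ →CP Matrix n n ℂ where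
  toLinearMap := krausLinearMap K
  map_cstarMatrix_nonneg' d M hM := by
    have flatten_posSemidef : (flatten (Fin d) m M).PosSemidef :=
      (map_nonneg (flatten (Fin d) m) hM).posSemidef
    rw [← (flatten (Fin d) n).symm_apply_apply (M.map _), flatten_map, ampliation_krausLinearMap]
    exact map_nonneg (flatten (Fin d) n).symm
      (posSemidef_krausLinearMap _ flatten_posSemidef).nonneg

theorem krausMap_apply [Fintype n] [DecidableEq m] [DecidableEq n] (K : ι → Matrix n m ℂ)
    (A : Matrix m m ℂ) : krausMap K A = ∑ i, K i * A * (K i)ᴴ := rfl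

end Kraus

section ChoiMap

variable {k m : Type*} [Fintype k] [Fintype m] [DecidableEq k]

/-- The unnormalised state `∑ a b, Tr[(|a⟩⟨b| ⊗ ρ) Q] |a⟩⟨b|` left with the receiver when the effect
`Q` is observed on `ρ` and one half of the maximally entangled vector `∑ a, |a⟩|a⟩`. -/
noncomputable def choiMap (Q : Matrix (k × m) (k × m) ℂ) (ρ : Matrix m m ℂ) : Matrix k k ℂ :=
  of fun a b => ((single a b 1 ⊗ₖ ρ) * Q).trace

theorem choiMap_apply (Q : Matrix (k × m) (k × m) ℂ) (ρ : Matrix m m ℂ) (a b : k) :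
    choiMap Q ρ a b = ((single a b 1 ⊗ₖ ρ) * Q).trace := rfl

theorem trace_choiMap (Q : Matrix (k × m) (k × m) ℂ) (ρ : Matrix m m ℂ) :
    (choiMap Q ρ).trace = (((1 : Matrix k k ℂ) ⊗ₖ ρ) * Q).trace := by
  rw [one_kronecker_eq_sum, Finset.sum_mul, trace_sum]
  rfl

theorem choiMap_sum {ι : Type*} (s : Finset ι) (Q : ι → Matrix (k × m) (k × m) ℂ)
    (ρ : Matrix m m ℂ) : choiMap (∑ i ∈ s, Q i) ρ = ∑ i ∈ s, choiMap (Q i) ρ := by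
  ext a b
  simp only [choiMap_apply, Finset.mul_sum, trace_sum, Matrix.sum_apply]

theorem choiMap_vecMulVec_star (M : Matrix m k ℂ) (ρ : Matrix m m ℂ) :
    choiMap (vecMulVec (fun s => M s.2 s.1) (star fun s => M s.2 s.1)) ρ = Mᴴ * ρ * M := by
  ext a b
  rw [choiMap_apply, trace_single_kronecker_mul]
  simp only [trace, diag_apply, submatrix_apply, Matrix.mul_apply, vecMulVec_apply,
    conjTranspose_apply, Finset.sum_mul, Pi.star_apply]
  rw [Finset.sum_comm]
  refine Finset.sum_congr rfl fun i _ => Finset.sum_congr rfl fun j _ => ?_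
  ring

theorem exists_choiMap_eq_sum {Q : Matrix (k × m) (k × m) ℂ} (hQ : Q.PosSemidef) :
    ∃ K : k × m → Matrix k m ℂ, ∀ ρ, choiMap Q ρ = ∑ w, K w * ρ * (K w)ᴴ := by
  classical
  obtain ⟨B, rfl⟩ := CStarAlgebra.nonneg_iff_eq_star_mul_self.1 hQ.nonneg
  have sum_rank_one : star B * B = ∑ w, vecMulVec (star (B w)) (B w) := by
    ext s t
    simp only [star_eq_conjTranspose, Matrix.mul_apply, conjTranspose_apply, Matrix.sum_apply,
      vecMulVec_apply, Pi.star_apply]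
  refine ⟨fun w => (of fun r a => star (B w (a, r)))ᴴ, fun ρ => ?_⟩
  rw [sum_rank_one, choiMap_sum]
  refine Finset.sum_congr rfl fun w _ => ?_
  rw [conjTranspose_conjTranspose, ← choiMap_vecMulVec_star]
  congr 2
  ext s
  simp

theorem exists_completelyPositive_eq_sum {U n : Type*} [Fintype U] [Fintype n] [DecidableEq m]
    [DecidableEq n] (V : U → Matrix n k ℂ) {Q : U → Matrix (k × m) (k × m) ℂ}
    (hQ : ∀ u, (Q u).PosSemidef) :
    ∃ T : Matrix m m ℂ →CP Matrix n n ℂ, ∀ ρ, T ρ = ∑ u, V u * choiMap (Q u) ρ * (V u)ᴴ := by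
  choose K hK using fun u => exists_choiMap_eq_sum (hQ u)
  refine ⟨krausMap fun z : U × (k × m) => V z.1 * K z.1 z.2, fun ρ => ?_⟩
  simp only [krausMap_apply, Fintype.sum_prod_type, hK, Matrix.mul_sum, Matrix.sum_mul,
    conjTranspose_mul, Matrix.mul_assoc]

end ChoiMap

section Teleportation

variable {U k m n : Type*}

/-- The rank-one operator `|V u⟩⟩⟨⟨V u|` on `ℂ^k ⊗ ℂ^n`, where `|V u⟩⟩` has the entries of `V u`. -/
noncomputable def bell (V : U → Matrix n k ℂ) (u : U) : Matrix (k × n) (k × n) ℂ :=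
  vecMulVec (fun s => V u s.2 s.1) (star fun s => V u s.2 s.1)

/-- The operators `V u`, scaled to have Hilbert–Schmidt norm one, are proportional to unitaries and
their vectorisations are an orthonormal basis; they are the corrections in a teleportation
scheme. -/
structure IsBellBasis [Fintype U] [Fintype k] [Fintype n] [DecidableEq k] [DecidableEq n]
    (V : U → Matrix n k ℂ) : Prop where
  card_eq : Fintype.card n = Fintype.card k
  mul_conjTranspose_self (u : U) : V u * (V u)ᴴ = (Fintype.card n : ℂ)⁻¹ • 1
  sum_bell : ∑ u, bell V u = 1

variable [Fintype U] [Fintype k] [Fintype n] [DecidableEq k] [DecidableEq n]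
  {V : U → Matrix n k ℂ}

theorem IsBellBasis.isPOVM_bell (hV : IsBellBasis V) : IsPOVM (bell V) :=
  ⟨fun _ => posSemidef_vecMulVec_self_star _, hV.sum_bell⟩

variable [Nonempty n]

theorem IsBellBasis.conjTranspose_mul_self (hV : IsBellBasis V) (u : U) :
    (V u)ᴴ * V u = (Fintype.card n : ℂ)⁻¹ • 1 := by
  have card_ne_zero : (Fintype.card n : ℂ) ≠ 0 := Nat.cast_ne_zero.2 Fintype.card_ne_zero
  have right_inverse : V u * ((Fintype.card n : ℂ) • (V u)ᴴ) = 1 := by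
    rw [Matrix.mul_smul, hV.mul_conjTranspose_self, smul_inv_smul₀ card_ne_zero]
  rw [eq_inv_smul_iff₀ card_ne_zero, ← Matrix.smul_mul]
  exact (mul_eq_one_comm_of_card_eq _ _ _ hV.card_eq).1 right_inverse

theorem IsBellBasis.card_index (hV : IsBellBasis V) :
    (Fintype.card U : ℂ) = Fintype.card n * Fintype.card n := by
  have trace_bell (u : U) : (bell V u).trace = 1 := by
    have : (bell V u).trace = (V u * (V u)ᴴ).trace := by
      simp only [bell, trace, diag_apply, vecMulVec_apply, Fintype.sum_prod_type_right,
        Matrix.mul_apply, conjTranspose_apply, Pi.star_apply]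
    rw [this, hV.mul_conjTranspose_self, trace_smul, trace_one, smul_eq_mul,
      inv_mul_cancel₀ (Nat.cast_ne_zero.2 Fintype.card_ne_zero)]
  have := congrArg trace hV.sum_bell
  simpa only [trace_sum, trace_bell, Finset.sum_const, Finset.card_univ, nsmul_eq_mul, mul_one,
    trace_one, Fintype.card_prod, Nat.cast_mul, ← hV.card_eq] using this

theorem IsBellBasis.sum_mul_choiMap_bell (hV : IsBellBasis V) (τ : Matrix n n ℂ) :
    ∑ u, V u * choiMap (bell V u) τ * (V u)ᴴ = τ := by
  have card_ne_zero : (Fintype.card n : ℂ) ≠ 0 := Nat.cast_ne_zero.2 Fintype.card_ne_zero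
  have corrected (u : U) : V u * choiMap (bell V u) τ * (V u)ᴴ =
      ((Fintype.card n : ℂ)⁻¹ * (Fintype.card n : ℂ)⁻¹) • τ := by
    calc V u * choiMap (bell V u) τ * (V u)ᴴ = (V u * (V u)ᴴ) * τ * (V u * (V u)ᴴ) := by
          simp only [bell, choiMap_vecMulVec_star, Matrix.mul_assoc]
      _ = _ := by
          simp only [hV.mul_conjTranspose_self, Matrix.smul_mul, Matrix.mul_smul, Matrix.one_mul,
            Matrix.mul_one, smul_smul]
  simp only [corrected, Finset.sum_const, Finset.card_univ]
  rw [← Nat.cast_smul_eq_nsmul ℂ, hV.card_index, smul_smul, ← mul_inv,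
    mul_inv_cancel₀ (mul_ne_zero card_ne_zero card_ne_zero), one_smul]

variable [Fintype m] [DecidableEq m] {Q : U → Matrix (k × m) (k × m) ℂ}

theorem IsBellBasis.trace_sum_mul_choiMap (hV : IsBellBasis V) (hQ : IsPOVM Q)
    (ρ : Matrix m m ℂ) :
    (∑ u, V u * choiMap (Q u) ρ * (V u)ᴴ).trace = ρ.trace := by
  have corrected (u : U) : (V u * choiMap (Q u) ρ * (V u)ᴴ).trace =
      (Fintype.card n : ℂ)⁻¹ * (((1 : Matrix k k ℂ) ⊗ₖ ρ) * Q u).trace := by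
    rw [trace_mul_cycle, hV.conjTranspose_mul_self, Matrix.smul_mul, Matrix.one_mul, trace_smul,
      trace_choiMap, smul_eq_mul]
  rw [trace_sum, Finset.sum_congr rfl fun u _ => corrected u, ← Finset.mul_sum, ← trace_sum,
    ← Finset.mul_sum, hQ.2, Matrix.mul_one, trace_kronecker, trace_one, ← hV.card_eq,
    inv_mul_cancel_left₀ (Nat.cast_ne_zero.2 Fintype.card_ne_zero)]

/-- Teleportation with the measurement `Q` in place of the Bell measurement: a state on which `Q`
has the outcome statistics of the Bell measurement on `τ` is received as `τ`. -/
theorem IsBellBasis.exists_channel (hV : IsBellBasis V) (hQ : IsPOVM Q) :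
    ∃ T : Matrix m m ℂ →CP Matrix n n ℂ, (∀ A : Matrix m m ℂ, (T A).trace = A.trace) ∧
      ∀ σ τ, (∀ u W, ((W ⊗ₖ σ) * Q u).trace = ((W ⊗ₖ τ) * bell V u).trace) → τ = T σ := by
  obtain ⟨T, hT⟩ := exists_completelyPositive_eq_sum V hQ.1
  refine ⟨T, fun A => by rw [hT, hV.trace_sum_mul_choiMap hQ], fun σ τ h => ?_⟩
  have choiMap_eq (u : U) : choiMap (Q u) σ = choiMap (bell V u) τ := by
    ext a b
    exact h u _
  simp only [hT, choiMap_eq, hV.sum_mul_choiMap_bell]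

theorem IsBellBasis.exists_channel_of_guessProb_mixture_le {X Y : Type*} [Fintype X] [Fintype Y]
    (hV : IsBellBasis V) [Nonempty U] {σ : X → Matrix m m ℂ} (hσ : ∀ x, IsDensity (σ x))
    {τ : X → Matrix n n ℂ} (hτ : ∀ x, IsDensity (τ x)) {ω : Y → Matrix k k ℂ}
    (hω : ∀ y, (ω y).PosSemidef) (hspan : Submodule.span ℂ (Set.range ω) = ⊤)
    (hguess : ∀ (q : U → ℝ) (c : U → Y × X → ℝ), q ∈ stdSimplex ℝ U →
      (∀ u, c u ∈ stdSimplex ℝ (Y × X)) →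
      guessProb q (fun u => mixture (c u) ω τ) ≤ guessProb q (fun u => mixture (c u) ω σ)) :
    ∃ T : Matrix m m ℂ →CP Matrix n n ℂ,
      (∀ A : Matrix m m ℂ, (T A).trace = A.trace) ∧ ∀ x, τ x = T (σ x) := by
  simp only [mixture_eq_sum] at hguess
  have trace_eq (z : Y × X) : (ω z.1 ⊗ₖ σ z.2).trace = (ω z.1 ⊗ₖ τ z.2).trace := by
    rw [trace_kronecker, trace_kronecker, (hσ z.2).2, (hτ z.2).2]
  obtain ⟨Q, hQ, statistics_eq⟩ := exists_isPOVM_statistics_eq trace_eq hguess hV.isPOVM_bell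
  obtain ⟨T, T_trace, hT⟩ := hV.exists_channel hQ
  refine ⟨T, T_trace, fun x => hT _ _ fun u W => ?_⟩
  exact trace_kronecker_mul_eq_of_span_eq_top hω hspan (hσ x).1 (hτ x).1
    (hQ.1 u) (hV.isPOVM_bell.1 u) (fun y => congrFun statistics_eq (u, y, x)) W

end Teleportation

section Weyl

variable {k n : Type*} {d : ℕ} [NeZero d]

/-- The Weyl–Heisenberg operators (a cyclic shift by `u.1` followed by the phases of `u.2`), scaled
to have Hilbert–Schmidt norm one. -/
noncomputable def weyl (f : k ≃ ZMod d) (e : n ≃ ZMod d) (u : ZMod d × ZMod d) : Matrix n k ℂ :=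
  of fun i a => if f a = e i + u.1 then (√d : ℂ)⁻¹ * ZMod.stdAddChar (u.2 * e i) else 0

theorem weyl_mul_star_weyl (f : k ≃ ZMod d) (e : n ≃ ZMod d) (u : ZMod d × ZMod d) (i j : n)
    (a b : k) : weyl f e u i a * star (weyl f e u j b) =
      if f a = e i + u.1 ∧ f b = e j + u.1 then
        (d : ℂ)⁻¹ * ZMod.stdAddChar (u.2 * (e i - e j)) else 0 := by
  have phase : (ZMod.stdAddChar (u.2 * (e i - e j)) : ℂ) =
      ZMod.stdAddChar (u.2 * e i) * star (ZMod.stdAddChar (u.2 * e j)) := by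
    rw [mul_sub, sub_eq_add_neg, AddChar.map_add_eq_mul, AddChar.map_neg_eq_conj]
    rfl
  have scale : (√d : ℂ)⁻¹ * star (√d : ℂ)⁻¹ = (d : ℂ)⁻¹ := by
    rw [star_inv₀, Complex.star_def, Complex.conj_ofReal, ← mul_inv, ← Complex.ofReal_mul,
      Real.mul_self_sqrt (Nat.cast_nonneg d), Complex.ofReal_natCast]
  rw [phase, ← scale]
  simp only [weyl, of_apply, apply_ite star, star_zero, star_mul', ite_and, ite_mul,
    mul_ite, zero_mul, mul_zero]
  split_ifs <;> ring

theorem sum_stdAddChar_mul_sub (e : n ≃ ZMod d) [DecidableEq n] (i j : n) :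
    ∑ x, (ZMod.stdAddChar (x * (e i - e j)) : ℂ) = if i = j then (d : ℂ) else 0 := by
  rw [AddChar.sum_mulShift _ (ZMod.isPrimitive_stdAddChar d)]
  simp only [sub_eq_zero, e.apply_eq_iff_eq, ZMod.card, Nat.cast_ite, Nat.cast_zero]

theorem isBellBasis_weyl [Fintype k] [Fintype n] [DecidableEq k] [DecidableEq n]
    (f : k ≃ ZMod d) (e : n ≃ ZMod d) : IsBellBasis (weyl f e) where
  card_eq := Fintype.card_congr (e.trans f.symm)
  mul_conjTranspose_self u := by
    ext i j
    simp only [Matrix.mul_apply, conjTranspose_apply, weyl_mul_star_weyl, Matrix.smul_apply,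
      one_apply]
    rw [← f.symm.sum_comp]
    simp only [f.apply_symm_apply, ite_and, Finset.sum_ite_eq', Finset.mem_univ, if_true,
      add_left_inj, e.apply_eq_iff_eq]
    split_ifs with hij
    · rw [hij, sub_self, mul_zero, AddChar.map_zero_eq_one, Fintype.card_congr e, ZMod.card,
        smul_eq_mul]
    · rw [smul_zero]
  sum_bell := by
    have d_ne_zero : (d : ℂ) ≠ 0 := Nat.cast_ne_zero.2 (NeZero.ne d)
    ext ⟨a, i⟩ ⟨b, j⟩
    have bell_apply (u : ZMod d × ZMod d) : bell (weyl f e) u (a, i) (b, j) =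
        weyl f e u i a * star (weyl f e u j b) := rfl
    have sum_phases (x : ZMod d) : ∑ y, bell (weyl f e) (x, y) (a, i) (b, j) =
        if f a = e i + x ∧ f b = e j + x then (if i = j then 1 else 0) else 0 := by
      simp only [bell_apply, weyl_mul_star_weyl]
      split_ifs with hx hij
      · rw [← Finset.mul_sum, sum_stdAddChar_mul_sub, if_pos hij, inv_mul_cancel₀ d_ne_zero]
      · rw [← Finset.mul_sum, sum_stdAddChar_mul_sub, if_neg hij, mul_zero]
      · rw [Finset.sum_const_zero]
    rw [Matrix.sum_apply, Fintype.sum_prod_type]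
    simp only [sum_phases, ← sub_eq_iff_eq_add', ite_and, Finset.sum_ite_eq, Finset.mem_univ,
      if_true, one_apply, Prod.mk.injEq]
    by_cases hij : i = j
    · simp [hij, sub_left_inj, eq_comm]
    · simp [hij]

end Weyl

end CQ

theorem mainTheorem9 {X Y R S S' : Type*} [Fintype X] [Fintype Y]
    [Fintype R] [DecidableEq R] [Fintype S] [DecidableEq S] [Nonempty S]
    [Fintype S'] [DecidableEq S'] (hS' : Fintype.card S' = Fintype.card S)
    (σ : X → Matrix R R ℂ) (hσ : ∀ x, CQ.IsDensity (σ x))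
    (τ : X → Matrix S S ℂ) (hτ : ∀ x, CQ.IsDensity (τ x))
    (ω : Y → Matrix S' S' ℂ) (hω : ∀ y, CQ.IsDensity (ω y))
    (hspan : Submodule.span ℂ (Set.range ω) = ⊤) :
    List.TFAE [
      -- domination in conditional min-entropy
      ∀ (U : Type) [Fintype U] [DecidableEq U] (q : U → ℝ) (c : U → Y × X → ℝ),
        q ∈ stdSimplex ℝ U → (∀ u, c u ∈ stdSimplex ℝ (Y × X)) →
        CQ.Hmin (CQ.cqState q fun u => CQ.mixture (c u) ω σ) ≤
          CQ.Hmin (CQ.cqState q fun u => CQ.mixture (c u) ω τ),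
      -- domination in guessing probability
      ∀ (U : Type) [Fintype U] (q : U → ℝ) (c : U → Y × X → ℝ),
        q ∈ stdSimplex ℝ U → (∀ u, c u ∈ stdSimplex ℝ (Y × X)) →
        CQ.guessProb q (fun u => CQ.mixture (c u) ω σ) ≥
          CQ.guessProb q (fun u => CQ.mixture (c u) ω τ),
      -- degradability by a completely positive trace-preserving map
      ∃ T : Matrix R R ℂ →CP Matrix S S ℂ,
        (∀ A : Matrix R R ℂ, (T A).trace = A.trace) ∧ ∀ x, τ x = T (σ x)] := by
  tfae_have 1 ↔ 2 := by
    classical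
    have hiff (U : Type) [Fintype U] [DecidableEq U] (q : U → ℝ) (c : U → Y × X → ℝ)
        (hq : q ∈ stdSimplex ℝ U) (hc : ∀ u, c u ∈ stdSimplex ℝ (Y × X)) :=
      CQ.Hmin_cqState_le_Hmin_cqState_iff hq (fun u => CQ.isDensity_mixture (hc u) hω hσ)
        (fun u => CQ.isDensity_mixture (hc u) hω hτ)
    exact ⟨fun h U _ q c hq hc => (hiff U q c hq hc).1 (h U q c hq hc),
      fun h U _ _ q c hq hc => (hiff U q c hq hc).2 (h U q c hq hc)⟩
  tfae_have 3 → 2 := by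
    rintro ⟨T, T_trace, hT⟩ U _ q c hq -
    have := CQ.nonempty_of_mem_stdSimplex hq
    obtain rfl : τ = fun x => T (σ x) := funext hT
    exact CQ.guessProb_mixture_map_le T T_trace q c ω σ
  tfae_have 2 → 3 := by
    intro h
    have : NeZero (Fintype.card S) := ⟨Fintype.card_ne_zero⟩
    have hV := CQ.isBellBasis_weyl (Fintype.equivOfCardEq (hS'.trans (ZMod.card _).symm))
      (Fintype.equivOfCardEq (ZMod.card (Fintype.card S)).symm)
    exact hV.exists_channel_of_guessProb_mixture_le hσ hτ (fun y => (hω y).1) hspan (h _)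
  tfae_finish
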